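/- Consider a memoryless state-dependent two-user multiple access channel with binary inputs $X_1, X_2\in\{0,1\}$, binary state $S$ and two-component output $Y=(Y_1,Y_2)$, $$Y_{1,i}=X_{1,i}+S_i+Z_{1,i} \pmod 2,\qquad Y_{2,i}=X_{2,i},$$ where the states $S_i$ are i.i.d. Bernoulli$(1/2)$, the noises $Z_{1,i}$ are i.i.d. Bernoulli$(p)$ with $0\le p\le 1$, and the two processes are independent. Encoder 1 has a message $W_1$, uniform on $\{1,\dots,M\}$ and independent of states and noise, knows the whole state sequence, and sends $X_1^n=\phi_1(W_1,S^n)$. Encoder 2 has no message, knows the states strictly causally, and sends $X_{2,i}=\phi_{2,i}(S^{i-1})$. All transmitted sequences satisfy $$\sum_{i=1}^n X_{1,i}\le nq_1,\qquad \sum_{i=1}^n X_{2,i}\le nq_2,$$ where $q_1\ge 0$ and $q_2\ge 1/2$. The decoder estimates $W_1$ from $Y^n$. A rate $R\ge 0$ (in bits) is achievable if for every $\epsilon>0$ there are an $n\ge 1$ and such a code of length $n$ with $M=\lceil 2^{nR}\rceil$ messages and average probability of error at most $\epsilon$. The capacity $\mathcal C$ is the supremum of the achievable rates. Then $$\mathcal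 C=\max_{p(x_1|s)} I(X_1;Y_1|S),$$ where the maximum is over all conditional laws $p(x_1|s)$ with $\mathbb E[X_1]\le q_1$, it is attained, and the mutual information (in bits) is computed for $S\sim$ Bernoulli$(1/2)$, $X_1\sim p(\cdot|S)$ and $Y_1=X_1+S+Z_1 \pmod 2$ with $Z_1\sim$ Bernoulli$(p)$ independent of $(S,X_1)$. -/

import Mathlib

open scoped BigOperators

/-- A memoryless state-dependent two-user multiple access channel with finite alphabets: an i.i.d.
state law `Q` and a transition law `W x₁ x₂ s y`, the probability of output `y` given the inputs
`x₁, x₂` and the state `s`. -/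
structure StateMAC (S X₁ X₂ Y : Type) [Fintype S] [Fintype Y] where
  /-- state law -/
  Q : S → ℝ
  /-- transition law -/
  W : X₁ → X₂ → S → Y → ℝ
  Q_mem : Q ∈ stdSimplex ℝ S
  W_mem : ∀ x₁ x₂ s, W x₁ x₂ s ∈ stdSimplex ℝ Y

/-- Block code of length `n` with `Mc` common and `M₁` individual messages. Encoder 1 sees both
messages and the whole state sequence. At time `i` Encoder 2 sees the common message and only the
states at the times before `i`. -/
structure MACCode (S X₁ X₂ Y : Type) (Mc M₁ n : ℕ) where
  /-- Encoder 1 -/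
  enc₁ : Fin Mc → Fin M₁ → (Fin n → S) → (Fin n → X₁)
  /-- Encoder 2, strictly causal in the state -/
  enc₂ : (i : Fin n) → Fin Mc → (Fin (i : ℕ) → S) → X₂
  /-- decoder -/
  dec : (Fin n → Y) → Fin Mc × Fin M₁

namespace MACCode

variable {S X₁ X₂ Y : Type} {Mc M₁ n : ℕ}

/-- The sequence sent by Encoder 2 for the common message `wc` and the state sequence `s`. -/
def word₂ (c : MACCode S X₁ X₂ Y Mc M₁ n) (wc : Fin Mc) (s : Fin n → S) : Fin n → X₂ :=
  fun i => c.enc₂ i wc (fun j => s (Fin.castLE i.isLt.le j))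

open Classical in
/-- Average probability of error, for independent uniform messages. -/
noncomputable def errorProb [Fintype S] [Fintype Y] (ch : StateMAC S X₁ X₂ Y)
    (c : MACCode S X₁ X₂ Y Mc M₁ n) : ℝ :=
  (1 / ((Mc : ℝ) * (M₁ : ℝ))) *
    ∑ wc : Fin Mc, ∑ w₁ : Fin M₁, ∑ s : Fin n → S, (∏ i, ch.Q (s i)) *
      ∑ y : Fin n → Y,
        if c.dec y = (wc, w₁) then 0
        else ∏ i, ch.W (c.enc₁ wc w₁ s i) (c.word₂ wc s i) (s i) (y i)

/-- Input constraints for binary input alphabets: every transmitted sequence of Encoder 1 has at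
most `n q₁` ones, and every transmitted sequence of Encoder 2 has at most `n q₂` ones. -/
def WeightConstrained (q₁ q₂ : ℝ) (c : MACCode S (ZMod 2) (ZMod 2) Y Mc M₁ n) : Prop :=
  (∀ wc w₁ s, ∑ i, ((c.enc₁ wc w₁ s i).val : ℝ) ≤ n * q₁) ∧
  (∀ wc s, ∑ i, ((c.word₂ wc s i).val : ℝ) ≤ n * q₂)

end MACCode

/-- `(Rc, R₁)` is achievable under the input constraints if for every `ε > 0` there is, for some
block length `n ≥ 1`, a `(2 ^ (n Rc), 2 ^ (n R₁), n, ε)` code obeying the constraints (the numbers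
of messages being rounded up to integers). Rates are in bits. -/
def StateMAC.Achievable {S Y : Type} [Fintype S] [Fintype Y]
    (ch : StateMAC S (ZMod 2) (ZMod 2) Y) (q₁ q₂ Rc R₁ : ℝ) : Prop :=
  0 ≤ Rc ∧ 0 ≤ R₁ ∧ ∀ ε : ℝ, 0 < ε → ∃ n : ℕ, 1 ≤ n ∧
    ∃ c : MACCode S (ZMod 2) (ZMod 2) Y
        ⌈(2 : ℝ) ^ ((n : ℝ) * Rc)⌉₊ ⌈(2 : ℝ) ^ ((n : ℝ) * R₁)⌉₊ n,
      c.WeightConstrained q₁ q₂ ∧ c.errorProb ch ≤ ε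

/-- The Bernoulli(`p`) probability mass function on `{0, 1}`. -/
def bern (p : ℝ) (z : ZMod 2) : ℝ := if z = 1 then p else 1 - p

theorem bern_mem {p : ℝ} (hp : p ∈ Set.Icc (0 : ℝ) 1) : bern p ∈ stdSimplex ℝ (ZMod 2) := by
  refine ⟨fun z => ?_, ?_⟩
  · unfold bern
    split_ifs
    · exact hp.1
    · exact sub_nonneg.2 hp.2
  · have h : ∑ z : ZMod 2, bern p z = bern p 0 + bern p 1 := Fin.sum_univ_two (bern p)
    rw [h]
    simp [bern]

/-- The binary example: `Y = (Y₁, Y₂)` with `Y₁ = X₁ + S + Z₁` modulo 2 and `Y₂ = X₂`, where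
`S ~ Bernoulli(1/2)` and `Z₁ ~ Bernoulli(p)` are independent. -/
noncomputable def binaryMAC (p : ℝ) (hp : p ∈ Set.Icc (0 : ℝ) 1) :
    StateMAC (ZMod 2) (ZMod 2) (ZMod 2) (ZMod 2 × ZMod 2) where
  Q := bern (1 / 2)
  W x₁ x₂ s y := bern p (y.1 - x₁ - s) * (if y.2 = x₂ then 1 else 0)
  Q_mem := bern_mem (by norm_num)
  W_mem x₁ x₂ s := by
    refine ⟨fun y => mul_nonneg ((bern_mem hp).1 _) (by split_ifs <;> norm_num), ?_⟩
    rw [Fintype.sum_prod_type]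
    simp only [mul_ite, mul_one, mul_zero, Finset.sum_ite_eq', Finset.mem_univ, if_true]
    rw [← (bern_mem hp).2]
    exact Fintype.sum_equiv (Equiv.subRight (x₁ + s)) _ _
      (fun y => by simp [sub_sub])

/-- Conditional mutual information `I(X; Y | S)`, in bits, of a joint probability mass function
`P s x y` on finite alphabets. -/
noncomputable def condMutualInfo {S X Y : Type} [Fintype S] [Fintype X] [Fintype Y]
    (P : S → X → Y → ℝ) : ℝ :=
  ∑ s, ∑ x, ∑ y, P s x y *
    Real.logb 2 (P s x y * (∑ x', ∑ y', P s x' y') / ((∑ y', P s x y') * (∑ x', P s x' y)))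

/-- The joint law of `(S, X₁, Y₁)` in the binary example when `X₁` given `S = s` has law `r s`. -/
noncomputable def singleLetterLaw (p : ℝ) (r : ZMod 2 → ZMod 2 → ℝ) (s x₁ y₁ : ZMod 2) : ℝ :=
  bern (1 / 2) s * r s x₁ * bern p (y₁ - x₁ - s)

/-- The conditional laws `p(x₁ | s)`, `r s x₁`, obeying the input constraint `E[X₁] ≤ q₁`. -/
def AdmissibleInput (q₁ : ℝ) : Set (ZMod 2 → ZMod 2 → ℝ) :=
  {r | (∀ s, r s ∈ stdSimplex ℝ (ZMod 2)) ∧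
    ∑ s, ∑ x₁, bern (1 / 2) s * r s x₁ * ((x₁.val : ℕ) : ℝ) ≤ q₁}

/-! For the converse, reveal the state to the decoder. Encoder 2 then conveys nothing, since its
word is a function of the state, and subtracting the state from the first output leaves a binary
symmetric channel with crossover `p` and at most `n q₁` ones per codeword. Its information in nats
is `bscInfo a p` with `a = min q₁ (1/2)`. `bsc_fano` bounds each code by comparing the true law with
an explicit test law through Gibbs' inequality. The single-letter maximum has the same value: given
`S = s` the channel is again this symmetric one, and by concavity and monotonicity
(`bscInfo_midpoint_le`, `bscInfo_le_of_le_min`) the best input ignores the state.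

For achievability, Encoder 2 sends the state uncoded with delay one, and the decoder subtracts it
and recovers the symmetric channel exactly. Since `q₂ ≥ 1/2` may hold with equality and the weight
constraint binds every state sequence, the relay stops when the ones seen so far exceed half the
block length. A short tail of zeros from Encoder 1 raises that budget above the typical weight of
the states, so stopping is rare by Chebyshev, at a vanishing cost in rate
(`errorProb_stateRelayCode_le`). The code for the symmetric channel comes from Feinstein's lemma,
which places the weight constraint on every codeword (`eventually_exists_bsc_code`). -/

/-! ### Product laws: marginals, means, variances, Chebyshev. -/

section ProductLaws

variable {α : Type*} [Fintype α]

theorem sum_prod_pmf_eq_one {n : ℕ} {f : Fin n → α → ℝ} (hf : ∀ i, ∑ a, f i a = 1) :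
    ∑ z : Fin n → α, ∏ i, f i (z i) = 1 := by
  classical
  have h := Finset.prod_univ_sum (fun _ : Fin n => (Finset.univ : Finset α)) f
  rw [Fintype.piFinset_univ] at h
  rw [← h]
  simp [hf]

/-- Expectation of a coordinatewise sum under a product law. -/
theorem sum_prod_mul_sum {n : ℕ} {f : Fin n → α → ℝ} (hf : ∀ i, ∑ a, f i a = 1)
    (g : Fin n → α → ℝ) :
    ∑ z : Fin n → α, (∏ i, f i (z i)) * ∑ j, g j (z j) = ∑ j, ∑ a, f j a * g j a := by
  classical
  simp_rw [Finset.mul_sum]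
  rw [Finset.sum_comm]
  refine Finset.sum_congr rfl fun j _ => ?_
  -- The factor `g j` is inserted at coordinate `j` only, so the sum factorises and every other
  -- coordinate integrates to 1.
  have h := Finset.prod_univ_sum (fun _ : Fin n => (Finset.univ : Finset α))
    (fun i a => f i a * if i = j then g i a else 1)
  rw [Fintype.piFinset_univ] at h
  simp only [Finset.prod_mul_distrib, Finset.prod_ite_eq', Finset.mem_univ, if_true] at h
  rw [← h, Finset.prod_eq_single j]
  · simp
  · intro i _ hij
    simp [hij, hf]
  · simp

/-- Marginal of a product law on the first `m` coordinates. -/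
theorem sum_prod_castAdd (m k : ℕ) {f : α → ℝ} (hf : ∑ a, f a = 1) (G : (Fin m → α) → ℝ) :
    ∑ z : Fin (m + k) → α, (∏ i, f (z i)) * G (fun i => z (Fin.castAdd k i)) =
      ∑ z : Fin m → α, (∏ i, f (z i)) * G z := by
  rw [← Fintype.sum_equiv (Fin.appendEquiv m k)
    (fun x : (Fin m → α) × (Fin k → α) => ((∏ i, f (x.1 i)) * G x.1) * ∏ i, f (x.2 i))]
  · rw [Fintype.sum_prod_type]
    refine Finset.sum_congr rfl fun z _ => ?_
    simp only
    rw [← Finset.mul_sum, sum_prod_pmf_eq_one (fun _ => hf), mul_one]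
  · rintro ⟨u, v⟩
    simp only [Fin.appendEquiv, Equiv.coe_fn_mk, Fin.prod_univ_add, Fin.append_left,
      Fin.append_right]
    ring

/-- Additivity of variance: when one coordinate is peeled off, the cross term vanishes because `g`
is centred. -/
theorem sum_prod_mul_sum_sq {f : α → ℝ} (hf : ∑ a, f a = 1) {g : α → ℝ}
    (hg : ∑ a, f a * g a = 0) (n : ℕ) :
    ∑ z : Fin n → α, (∏ i, f (z i)) * (∑ i, g (z i)) ^ 2 = n * ∑ a, f a * g a ^ 2 := by
  induction n with
  | zero => simp
  | succ n ih =>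
    have h0 : ∑ z : Fin n → α, (∏ i, f (z i)) * ∑ i, g (z i) = 0 := by
      rw [sum_prod_mul_sum (fun _ => hf) (fun _ => g)]
      simp [hg]
    rw [← Fintype.sum_equiv (Fin.consEquiv (fun _ : Fin (n + 1) => α))
      (fun x : α × (Fin n → α) => (f x.1 * g x.1 ^ 2) * ∏ i, f (x.2 i)
        + 2 * (f x.1 * g x.1) * ((∏ i, f (x.2 i)) * ∑ i, g (x.2 i))
        + f x.1 * ((∏ i, f (x.2 i)) * (∑ i, g (x.2 i)) ^ 2))]
    · rw [Fintype.sum_prod_type]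
      simp only [Finset.sum_add_distrib, ← Finset.mul_sum, h0, ih, ← Finset.sum_mul, hf,
        sum_prod_pmf_eq_one (fun _ : Fin n => hf)]
      push_cast
      ring
    · rintro ⟨u, v⟩
      simp only [Fin.consEquiv, Equiv.coe_fn_mk, Fin.prod_univ_succ, Fin.sum_univ_succ,
        Fin.cons_zero, Fin.cons_succ]
      ring

/-- Chebyshev's inequality for the sum of an independent identically distributed sample. -/
theorem sum_prod_ite_le_of_dev {f : α → ℝ} (hf : f ∈ stdSimplex ℝ α) (g : α → ℝ) (n : ℕ)
    {d : ℝ} (hd : 0 < d) (E : (Fin n → α) → Prop) [DecidablePred E]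
    (hE : ∀ z, (∏ i, f (z i)) ≠ 0 → E z → d ≤ |∑ i, g (z i) - n * ∑ a, f a * g a|) :
    ∑ z : Fin n → α, (∏ i, f (z i)) * (if E z then 1 else 0) ≤
      n * (∑ a, f a * (g a - ∑ b, f b * g b) ^ 2) / d ^ 2 := by
  set μ := ∑ b, f b * g b with hμ
  have h := sum_prod_mul_sum_sq hf.2 (g := fun a => g a - μ)
    (by simp only [mul_sub, Finset.sum_sub_distrib, ← Finset.sum_mul, hf.2, ← hμ]; ring) n
  rw [le_div_iff₀ (by positivity), ← h, Finset.sum_mul]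
  refine Finset.sum_le_sum fun z _ => ?_
  have h0 : 0 ≤ ∏ i, f (z i) := Finset.prod_nonneg fun i _ => hf.1 _
  rw [mul_assoc]
  -- Points of mass zero are exempt from `hE`. This matters when `g` is a log-likelihood ratio,
  -- where `Real.log 0 = 0` would give meaningless deviations.
  by_cases hz : ∏ i, f (z i) = 0
  · simp [hz]
  refine mul_le_mul_of_nonneg_left ?_ h0
  split_ifs with hEz
  · have := hE z hz hEz
    rw [one_mul, Finset.sum_sub_distrib]
    simp only [Finset.sum_const, Finset.card_univ, Fintype.card_fin, nsmul_eq_mul]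
    rw [← sq_abs (_ - _)]
    gcongr
  · simpa using sq_nonneg _

end ProductLaws

/-! ### Feinstein's lemma with a constraint on the codewords. -/

section Feinstein

variable {X Y : Type*} [Fintype X] [Fintype Y]

open Classical in
/-- Feinstein's maximal code construction. -/
theorem exists_disjoint_family_of_sum_lt {P : X → ℝ} (hP : P ∈ stdSimplex ℝ X)
    {W : X → Y → ℝ} (hW : ∀ x, W x ∈ stdSimplex ℝ Y) (B : X → Finset Y) {β : ℝ} (hβ : 0 ≤ β)
    (hB : ∀ x, ∑ y ∈ B x, ∑ x', P x' * W x' y ≤ β) (G : X → Prop) {ε : ℝ} (hε : ε ≤ 1) (M : ℕ)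
    (hM : M * β + ∑ x, ∑ y, P x * W x y * (if G x ∧ y ∈ B x then 0 else 1) < ε) :
    ∃ (c : Fin M → X) (D : Fin M → Finset Y), (∀ i j, i ≠ j → Disjoint (D i) (D j)) ∧
      ∀ i, G (c i) ∧ D i ⊆ B (c i) ∧ 1 - ε ≤ ∑ y ∈ D i, W (c i) y := by
  induction M with
  | zero => exact ⟨Fin.elim0, Fin.elim0, fun i => i.elim0, fun i => i.elim0⟩
  | succ M ih =>
    push_cast at hM
    obtain ⟨c, D, hD, hc⟩ := ih (by linarith)
    set U : Finset Y := Finset.univ.biUnion D with hU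
    -- If no further codeword fits, every `x` satisfies `1 ≤ (1 - ε) + W x (U) + W x (bad)`.
    -- Averaging over `P` gives `ε ≤ M β + P(bad)`, contradicting `hM`.
    have hx : ∃ x, G x ∧ 1 - ε ≤ ∑ y ∈ B x \ U, W x y := by
      by_contra! hcon
      have hUq : ∑ y ∈ U, ∑ x, P x * W x y ≤ M * β := by
        rw [hU, Finset.sum_biUnion (fun i _ j _ hij => hD i j hij)]
        calc _ ≤ ∑ i : Fin M, β := Finset.sum_le_sum fun i _ => (hB (c i)).trans' <|
              Finset.sum_le_sum_of_subset_of_nonneg (hc i).2.1 fun y _ _ =>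
                Finset.sum_nonneg fun x _ => mul_nonneg (hP.1 x) ((hW x).1 y)
          _ = M * β := by simp
      have hpt : ∀ x, P x * 1 ≤ P x * ((1 - ε) + ∑ y ∈ U, W x y
          + ∑ y, W x y * (if G x ∧ y ∈ B x then 0 else 1)) := by
        intro x
        refine mul_le_mul_of_nonneg_left ?_ (hP.1 x)
        have hUn : 0 ≤ ∑ y ∈ U, W x y := Finset.sum_nonneg fun y _ => (hW x).1 y
        by_cases hG : G x
        · have h1 := hcon x hG
          have h2 : ∑ y ∈ B x, W x y ≤ ∑ y ∈ B x \ U, W x y + ∑ y ∈ U, W x y := by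
            rw [← Finset.sum_union Finset.sdiff_disjoint]
            refine Finset.sum_le_sum_of_subset_of_nonneg ?_ fun y _ _ => (hW x).1 y
            intro y hy
            simp [hy]
          have h3 : ∑ y ∈ B x, W x y + ∑ y, W x y * (if G x ∧ y ∈ B x then 0 else 1) = 1 := by
            refine Eq.trans ?_ (hW x).2
            rw [← Finset.sum_ite_mem_eq (B x) (W x),
              ← Finset.sum_add_distrib]
            refine Finset.sum_congr rfl fun y _ => ?_
            by_cases hy : y ∈ B x <;> simp [hy, hG]
          linarith
        -- An `x` violating the constraint counts as entirely bad, and `ε ≤ 1` makes the remaining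
        -- terms nonnegative.
        · have : ∑ y, W x y * (if G x ∧ y ∈ B x then 0 else 1) = 1 := by
            simp [hG, (hW x).2]
          rw [this]
          linarith
      have hs := Finset.sum_le_sum fun x (_ : x ∈ Finset.univ) => hpt x
      simp only [mul_add, Finset.sum_add_distrib, ← Finset.sum_mul, hP.2, Finset.mul_sum] at hs
      rw [Finset.sum_comm] at hUq
      simp only [mul_assoc] at hM
      linarith
    obtain ⟨x, hGx, hx⟩ := hx
    refine ⟨Fin.cons x c, Fin.cons (B x \ U) D, ?_, ?_⟩
    · have hdis : ∀ j, Disjoint (B x \ U) (D j) := fun j =>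
        Finset.disjoint_of_subset_right (Finset.subset_biUnion_of_mem D (Finset.mem_univ j))
          Finset.sdiff_disjoint
      intro i j
      refine Fin.cases ?_ (fun i => ?_) i <;> refine Fin.cases ?_ (fun j => ?_) j
      · simp
      · intro _; simpa using hdis j
      · intro _; simpa using (hdis i).symm
      · intro hij
        simpa using hD i j (fun h => hij (by rw [h]))
    · intro i
      refine Fin.cases ?_ (fun i => ?_) i
      · exact ⟨hGx, Finset.sdiff_subset, hx⟩
      · simpa using hc i

open Classical in
/-- Feinstein's lemma with decoder. -/
theorem exists_code_of_sum_lt {P : X → ℝ} (hP : P ∈ stdSimplex ℝ X)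
    {W : X → Y → ℝ} (hW : ∀ x, W x ∈ stdSimplex ℝ Y) (B : X → Finset Y) {β : ℝ} (hβ : 0 ≤ β)
    (hB : ∀ x, ∑ y ∈ B x, ∑ x', P x' * W x' y ≤ β) (G : X → Prop) {ε : ℝ} (hε : ε ≤ 1) (M : ℕ)
    (hM0 : 0 < M)
    (hM : M * β + ∑ x, ∑ y, P x * W x y * (if G x ∧ y ∈ B x then 0 else 1) < ε) :
    ∃ (c : Fin M → X) (dec : Y → Fin M), ∀ i, G (c i) ∧
      ∑ y, W (c i) y * (if dec y = i then 0 else 1) ≤ ε := by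
  obtain ⟨c, D, hD, hc⟩ := exists_disjoint_family_of_sum_lt hP hW B hβ hB G hε M hM
  refine ⟨c, fun y => if h : ∃ i, y ∈ D i then h.choose else ⟨0, hM0⟩, fun i => ⟨(hc i).1, ?_⟩⟩
  have hdec : ∀ y ∈ D i, (if h : ∃ i, y ∈ D i then h.choose else ⟨0, hM0⟩) = i := by
    intro y hy
    have h : ∃ i, y ∈ D i := ⟨i, hy⟩
    rw [dif_pos h]
    by_contra hne
    exact Finset.disjoint_left.1 (hD _ _ hne) h.choose_spec hy
  have h1 := (hc i).2.2
  have h2 : ∑ y ∈ D i, W (c i) y + ∑ y, W (c i) y *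
      (if (if h : ∃ i, y ∈ D i then h.choose else ⟨0, hM0⟩) = i then 0 else 1) ≤ 1 := by
    refine le_of_le_of_eq ?_ (hW (c i)).2
    rw [← Finset.sum_ite_mem_eq (D i) (W (c i)),
      ← Finset.sum_add_distrib]
    refine Finset.sum_le_sum fun y _ => ?_
    have := (hW (c i)).1 y
    by_cases hy : y ∈ D i
    · rw [if_pos (hdec y hy)]; simp [hy]
    · rw [if_neg hy]; split_ifs <;> simp [this]
  linarith

end Feinstein

/-! ### Binary convolution, binary entropy and the information of the symmetric channel. -/

section Binary

theorem sum_zmod_two (f : ZMod 2 → ℝ) : ∑ z, f z = f 0 + f 1 := Fin.sum_univ_two f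

theorem zmod_two_eq (z : ZMod 2) : z = 0 ∨ z = 1 := by
  revert z; decide

@[simp] theorem bern_zero (p : ℝ) : bern p 0 = 1 - p := by simp [bern]

@[simp] theorem bern_one (p : ℝ) : bern p 1 = p := by simp [bern]

theorem bern_pos {p : ℝ} (h0 : 0 < p) (h1 : p < 1) (z : ZMod 2) : 0 < bern p z := by
  rcases zmod_two_eq z with rfl | rfl <;> simp [h0, h1]

theorem eq_bern_of_mem {r : ZMod 2 → ℝ} (hr : r ∈ stdSimplex ℝ (ZMod 2)) : r = bern (r 1) := by
  have h := hr.2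
  rw [sum_zmod_two] at h
  funext z
  rcases zmod_two_eq z with rfl | rfl
  · rw [bern_zero]; linarith
  · simp

theorem apply_one_mem {r : ZMod 2 → ℝ} (hr : r ∈ stdSimplex ℝ (ZMod 2)) :
    r 1 ∈ Set.Icc (0 : ℝ) 1 := by
  have h := hr.2
  rw [sum_zmod_two] at h
  exact ⟨hr.1 1, by linarith [hr.1 0]⟩

/-- Parameter of the modulo-2 sum of independent Bernoulli(`a`) and Bernoulli(`p`) bits. -/
def binConv (a p : ℝ) : ℝ := a * (1 - p) + (1 - a) * p

theorem sum_bern_mul_bern_sub (a p : ℝ) (y : ZMod 2) :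
    ∑ x, bern a x * bern p (y - x) = bern (binConv a p) y := by
  rw [sum_zmod_two]
  rcases zmod_two_eq y with rfl | rfl
  · rw [show (0 - 1 : ZMod 2) = 1 from by decide]
    simp [binConv]; ring
  · simp [binConv]; ring

theorem binConv_mem {a p : ℝ} (ha : a ∈ Set.Icc (0 : ℝ) 1) (hp : p ∈ Set.Icc (0 : ℝ) 1) :
    binConv a p ∈ Set.Icc (0 : ℝ) 1 := by
  obtain ⟨ha0, ha1⟩ := ha
  obtain ⟨hp0, hp1⟩ := hp
  unfold binConv
  constructor <;> nlinarith [mul_nonneg ha0 hp0, mul_nonneg ha0 (sub_nonneg.2 hp1),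
    mul_nonneg (sub_nonneg.2 ha1) hp0, mul_nonneg (sub_nonneg.2 ha1) (sub_nonneg.2 hp1)]

/-- An input parameter strictly inside `(0, 1)` keeps the output law positive even for `p = 0` or `p
= 1`, so logarithms of output probabilities are genuine. -/
theorem binConv_pos {a p : ℝ} (ha0 : 0 < a) (ha1 : a < 1) (hp : p ∈ Set.Icc (0 : ℝ) 1) :
    0 < binConv a p := by
  obtain ⟨hp0, hp1⟩ := hp
  unfold binConv
  rcases hp0.eq_or_lt with h | h
  · rw [← h]; simpa using ha0
  · have := mul_pos (sub_pos.2 ha1) h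
    have := mul_nonneg ha0.le (sub_nonneg.2 hp1)
    linarith

theorem binConv_lt_one {a p : ℝ} (ha0 : 0 < a) (ha1 : a < 1) (hp : p ∈ Set.Icc (0 : ℝ) 1) :
    binConv a p < 1 := by
  have h := binConv_pos ha0 ha1 (p := 1 - p) ⟨by linarith [hp.2], by linarith [hp.1]⟩
  unfold binConv at *
  linarith

theorem binConv_half (p : ℝ) : binConv (1 / 2) p = 2⁻¹ := by
  unfold binConv; ring

theorem binEntropy_eq_neg (t : ℝ) :
    Real.binEntropy t = -(t * Real.log t + (1 - t) * Real.log (1 - t)) := by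
  simp only [Real.binEntropy, Real.log_inv]; ring

theorem sum_bern_mul_log_bern (p : ℝ) :
    ∑ z, bern p z * Real.log (bern p z) = -Real.binEntropy p := by
  rw [sum_zmod_two, binEntropy_eq_neg, bern_zero, bern_one]; ring

/-- The mutual information, in nats, between input and output of a binary symmetric channel
with crossover probability `p` and input law Bernoulli(`a`). -/
noncomputable def bscInfo (a p : ℝ) : ℝ := Real.binEntropy (binConv a p) - Real.binEntropy p

theorem continuous_bscInfo (p : ℝ) : Continuous fun a => bscInfo a p := by
  unfold bscInfo binConv; fun_prop

/-- Binary entropy is symmetric about `1/2` and increasing on `[0, 1/2]`, so it depends only on the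
distance to `1/2`. -/
theorem binEntropy_mono_of_abs_le {s t : ℝ} (hs : s ∈ Set.Icc (0 : ℝ) 1)
    (ht : t ∈ Set.Icc (0 : ℝ) 1) (h : |t - 1 / 2| ≤ |s - 1 / 2|) :
    Real.binEntropy s ≤ Real.binEntropy t := by
  have key : ∀ u ∈ Set.Icc (0 : ℝ) 1,
      Real.binEntropy u = Real.binEntropy (1 / 2 - |u - 1 / 2|) := by
    intro u _
    rcases abs_cases (u - 1 / 2) with ⟨h1, _⟩ | ⟨h1, _⟩
    · rw [h1, ← Real.binEntropy_one_sub]; ring_nf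
    · rw [h1]; ring_nf
  have hab : ∀ u ∈ Set.Icc (0 : ℝ) 1, 1 / 2 - |u - 1 / 2| ∈ Set.Icc (0 : ℝ) 2⁻¹ := by
    intro u hu
    have : |u - 1 / 2| ≤ 1 / 2 := abs_le.2 ⟨by linarith [hu.1], by linarith [hu.2]⟩
    exact ⟨by linarith, by norm_num⟩
  rw [key s hs, key t ht]
  exact Real.binEntropy_strictMonoOn.monotoneOn (hab s hs) (hab t ht) (by linarith)

/-- Convolution with `p` multiplies the signed distance to `1/2` by `1 - 2p`, so the best admissible
input is the one closest to `1/2`. -/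
theorem bscInfo_le_of_le_min {a b q p : ℝ} (hp : p ∈ Set.Icc (0 : ℝ) 1)
    (ha : a = min q (1 / 2)) (ha0 : 0 ≤ a) (hb : b ∈ Set.Icc (0 : ℝ) 1) (hbq : b ≤ q) :
    bscInfo b p ≤ bscInfo a p := by
  have ha1 : a ≤ 1 / 2 := ha ▸ min_le_right _ _
  refine sub_le_sub_right (binEntropy_mono_of_abs_le (binConv_mem hb hp)
    (binConv_mem ⟨ha0, by linarith⟩ hp) ?_) _
  have e : ∀ u, binConv u p - 1 / 2 = (1 - 2 * p) * (u - 1 / 2) := fun u => by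
    unfold binConv; ring
  rw [e, e, abs_mul, abs_mul]
  refine mul_le_mul_of_nonneg_left ?_ (abs_nonneg _)
  rcases min_cases q (1 / 2) with ⟨h, h'⟩ | ⟨h, h'⟩
  · rw [abs_of_nonpos (by linarith), abs_of_nonpos (by linarith)]; linarith
  · rw [ha, h]; simp

/-- Concavity of entropy composed with a map affine in the input parameter. The equal weights are
those of the uniform state. -/
theorem bscInfo_midpoint_le {a b p : ℝ} (hp : p ∈ Set.Icc (0 : ℝ) 1)
    (ha : a ∈ Set.Icc (0 : ℝ) 1) (hb : b ∈ Set.Icc (0 : ℝ) 1) :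
    1 / 2 * (bscInfo a p + bscInfo b p) ≤ bscInfo ((a + b) / 2) p := by
  have h := Real.strictConcave_binEntropy.concaveOn.2 (binConv_mem ha hp) (binConv_mem hb hp)
    (show (0 : ℝ) ≤ 1 / 2 by norm_num) (show (0 : ℝ) ≤ 1 / 2 by norm_num) (by norm_num)
  have e : (1 / 2 : ℝ) • binConv a p + (1 / 2 : ℝ) • binConv b p = binConv ((a + b) / 2) p := by
    simp only [binConv, smul_eq_mul]; ring
  rw [e] at h
  simp only [smul_eq_mul] at h
  unfold bscInfo
  linarith

end Binary

/-! ### Evaluation of the single-letter maximum. -/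

section SingleLetter

variable {p : ℝ} {r : ZMod 2 → ZMod 2 → ℝ}

/-- Where the joint law vanishes, the prefactor kills both sides. Elsewhere the output probability
is positive too, and the logarithm of the quotient splits. -/
theorem singleLetterLaw_mul_logb (hp : p ∈ Set.Icc (0 : ℝ) 1)
    (hr : ∀ s, r s ∈ stdSimplex ℝ (ZMod 2)) (s x y : ZMod 2) :
    singleLetterLaw p r s x y * Real.logb 2 (singleLetterLaw p r s x y *
        (∑ x', ∑ y', singleLetterLaw p r s x' y') /
        ((∑ y', singleLetterLaw p r s x y') * (∑ x', singleLetterLaw p r s x' y))) =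
      1 / 2 * r s x * bern p (y - x - s) *
        (Real.log (bern p (y - x - s)) - Real.log (bern (binConv (r s 1) p) (y - s))) /
          Real.log 2 := by
  have hb : ∀ u : ZMod 2, bern (1 / 2) u = 1 / 2 := fun u => by
    rcases zmod_two_eq u with rfl | rfl <;> norm_num
  have hsum : ∀ x', ∑ y', bern p (y' - x' - s) = 1 := fun x' => by
    rw [← (bern_mem hp).2]
    exact Fintype.sum_equiv (Equiv.subRight (x' + s)) _ _ (fun y => by simp [sub_sub])
  have hX : ∀ x', ∑ y', singleLetterLaw p r s x' y' = 1 / 2 * r s x' := fun x' => by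
    simp only [singleLetterLaw, ← Finset.mul_sum, hsum, hb, mul_one]
  have hY : ∑ x', singleLetterLaw p r s x' y = 1 / 2 * bern (binConv (r s 1) p) (y - s) := by
    simp only [singleLetterLaw, hb, mul_assoc, ← Finset.mul_sum]
    rw [← sum_bern_mul_bern_sub, ← eq_bern_of_mem (hr s)]
    simp only [sub_right_comm]
  have hXY : ∑ x', ∑ y', singleLetterLaw p r s x' y' = 1 / 2 := by
    simp only [hX, ← Finset.mul_sum, (hr s).2, mul_one]
  rw [hXY, hX, hY]
  simp only [singleLetterLaw, hb]
  by_cases hrx : r s x = 0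
  · simp [hrx]
  by_cases hbx : bern p (y - x - s) = 0
  · simp [hbx]
  have ht : bern (binConv (r s 1) p) (y - s) ≠ 0 := by
    rw [← sum_bern_mul_bern_sub, ← eq_bern_of_mem (hr s)]
    refine (lt_of_lt_of_le ?_ (Finset.single_le_sum (f := fun x => r s x * bern p (y - s - x))
      (fun x' _ => mul_nonneg ((hr s).1 _) ((bern_mem hp).1 _)) (Finset.mem_univ x))).ne'
    rw [sub_right_comm]
    exact mul_pos (lt_of_le_of_ne ((hr s).1 x) (Ne.symm hrx))
      (lt_of_le_of_ne ((bern_mem hp).1 _) (Ne.symm hbx))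
  rw [show 1 / 2 * r s x * bern p (y - x - s) * (1 / 2) /
      (1 / 2 * r s x * (1 / 2 * bern (binConv (r s 1) p) (y - s))) =
      bern p (y - x - s) / bern (binConv (r s 1) p) (y - s) from by field_simp]
  rw [Real.logb, Real.log_div hbx ht]
  ring

/-- Given `S = s`, the shifted output `Y₁ - s = X₁ + Z₁` is that of a symmetric channel with input
Bernoulli(`r s 1`). -/
theorem condMutualInfo_singleLetterLaw (hp : p ∈ Set.Icc (0 : ℝ) 1)
    (hr : ∀ s, r s ∈ stdSimplex ℝ (ZMod 2)) :
    condMutualInfo (singleLetterLaw p r) =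
      1 / 2 * (bscInfo (r 0 1) p + bscInfo (r 1 1) p) / Real.log 2 := by
  unfold condMutualInfo
  simp only [singleLetterLaw_mul_logb hp hr]
  have h0 : ∀ s, r s 0 = 1 - r s 1 := fun s => by
    have := (hr s).2
    rw [sum_zmod_two] at this
    linarith
  simp only [sum_zmod_two, h0, sub_self, sub_zero, bern_zero, bern_one,
    show (0 - 1 : ZMod 2) = 1 from by decide, bscInfo, binEntropy_eq_neg]
  unfold binConv
  ring

/-- The single-letter maximum is attained by an input that is independent of the state. -/
theorem isGreatest_condMutualInfo {q₁ : ℝ} (hp : p ∈ Set.Icc (0 : ℝ) 1) (hq₁ : 0 ≤ q₁) :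
    IsGreatest ((fun r => condMutualInfo (singleLetterLaw p r)) '' AdmissibleInput q₁)
      (bscInfo (min q₁ (1 / 2)) p / Real.log 2) := by
  have ha0 : 0 ≤ min q₁ (1 / 2) := le_min hq₁ (by norm_num)
  have ha1 : min q₁ (1 / 2) ≤ 1 / 2 := min_le_right _ _
  have hlog : 0 < Real.log 2 := Real.log_pos (by norm_num)
  have hval : ((1 : ZMod 2).val : ℝ) = 1 := by norm_num [ZMod.val_one]
  constructor
  · have hmem : ∀ _ : ZMod 2, bern (min q₁ (1 / 2)) ∈ stdSimplex ℝ (ZMod 2) := fun _ =>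
      bern_mem ⟨ha0, by linarith⟩
    refine ⟨fun _ => bern (min q₁ (1 / 2)), ⟨hmem, ?_⟩, ?_⟩
    · simp only [sum_zmod_two, bern_zero, bern_one, ZMod.val_zero, hval]
      have := min_le_left q₁ (1 / 2)
      push_cast
      linarith
    · simp only [condMutualInfo_singleLetterLaw hp hmem, bern_one]
      ring
  · rintro _ ⟨r, ⟨hr, hq⟩, rfl⟩
    simp only [sum_zmod_two, bern_zero, bern_one, ZMod.val_zero, hval] at hq
    push_cast at hq
    simp only [condMutualInfo_singleLetterLaw hp hr]
    have h0 := apply_one_mem (hr 0)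
    have h1 := apply_one_mem (hr 1)
    gcongr
    exact (bscInfo_midpoint_le hp h0 h1).trans (bscInfo_le_of_le_min hp rfl ha0
      ⟨by linarith [h0.1, h1.1], by linarith [h0.2, h1.2]⟩ (by linarith))

end SingleLetter

/-! ### Converse for the symmetric channel. -/

section Converse

/-- Gibbs' inequality. -/
theorem sum_mul_log_le_sum_mul_log {Ω : Type*} [Fintype Ω] {P R : Ω → ℝ}
    (hP : P ∈ stdSimplex ℝ Ω) (hR : ∀ ω, 0 < R ω) (hR1 : ∑ ω, R ω ≤ 1) :
    ∑ ω, P ω * Real.log (R ω) ≤ ∑ ω, P ω * Real.log (P ω) := by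
  have h : ∀ ω, P ω * Real.log (R ω) - P ω * Real.log (P ω) ≤ R ω - P ω := by
    intro ω
    rcases (hP.1 ω).eq_or_lt with h0 | h0
    · rw [← h0]; simpa using (hR ω).le
    · rw [← mul_sub, ← Real.log_div (hR ω).ne' h0.ne']
      calc _ ≤ P ω * (R ω / P ω - 1) :=
            mul_le_mul_of_nonneg_left (Real.log_le_sub_one_of_pos (div_pos (hR ω) h0)) h0.le
        _ = R ω - P ω := by field_simp
  have hs := Finset.sum_le_sum fun ω (_ : ω ∈ Finset.univ) => h ω
  rw [Finset.sum_sub_distrib, Finset.sum_sub_distrib, hP.2] at hs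
  linarith

theorem sum_prod_mul_log_prod {α : Type*} [Fintype α] {f : α → ℝ} (hf : f ∈ stdSimplex ℝ α)
    (n : ℕ) :
    ∑ z : Fin n → α, (∏ i, f (z i)) * Real.log (∏ i, f (z i)) =
      n * ∑ a, f a * Real.log (f a) := by
  have h := sum_prod_mul_sum (n := n) (fun _ => hf.2) (fun _ a => Real.log (f a))
  simp only [Finset.sum_const, Finset.card_univ, Fintype.card_fin, nsmul_eq_mul] at h
  rw [← h]
  refine Finset.sum_congr rfl fun z _ => ?_
  by_cases hz : ∏ i, f (z i) = 0
  · simp [hz]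
  · rw [Real.log_prod (fun i hi h0 => hz (Finset.prod_eq_zero hi h0))]

/-- Cross-entropy of the output of a binary symmetric channel for one input letter. -/
theorem sum_bern_mul_log_bern_add (p t : ℝ) (x : ZMod 2) :
    ∑ z, bern p z * Real.log (bern t (x + z)) =
      p * Real.log t + (1 - p) * Real.log (1 - t)
        + (x.val : ℝ) * ((1 - 2 * p) * (Real.log t - Real.log (1 - t))) := by
  rw [sum_zmod_two]
  rcases zmod_two_eq x with rfl | rfl
  · simp; ring
  · rw [show (1 + 1 : ZMod 2) = 0 from by decide, show ((1 : ZMod 2).val : ℝ) = 1 from by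
      norm_num [ZMod.val_one]]
    simp; ring

/-- The expected log-likelihood of the output under Bernoulli(`t`), `t = binConv a p`, is affine in
the weight of the codeword. Its slope is nonpositive because `1 - 2t = (1 - 2a)(1 - 2p)` has the
sign of `1 - 2p` or is zero, so weight `n a` is the worst case. For `a = 1/2` the slope is zero and
no weight bound is needed. -/
theorem neg_mul_binEntropy_le_sum {p q a : ℝ} (hp : p ∈ Set.Icc (0 : ℝ) 1) (ha0 : 0 < a)
    (ha1 : a ≤ 1 / 2) (hqa : q ≤ a ∨ a = 1 / 2) {n : ℕ} (x : Fin n → ZMod 2)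
    (hx : ∑ i, ((x i).val : ℝ) ≤ n * q) :
    -(n * Real.binEntropy (binConv a p)) ≤
      ∑ i, ∑ z, bern p z * Real.log (bern (binConv a p) (x i + z)) := by
  simp only [sum_bern_mul_log_bern_add, Finset.sum_add_distrib, ← Finset.sum_mul]
  simp only [Finset.sum_const, Finset.card_univ, Fintype.card_fin, nsmul_eq_mul]
  set t := binConv a p with ht
  have ht0 : 0 < t := binConv_pos ha0 (by linarith) hp
  have ht1 : t < 1 := binConv_lt_one ha0 (by linarith) hp
  have heq : -(n * Real.binEntropy t) = n * (p * Real.log t + (1 - p) * Real.log (1 - t))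
      + (n * a) * ((1 - 2 * p) * (Real.log t - Real.log (1 - t))) := by
    rw [binEntropy_eq_neg]
    have : t = a * (1 - p) + (1 - a) * p := ht
    linear_combination n * (Real.log t - Real.log (1 - t)) * this
  rw [heq]
  refine add_le_add (le_of_eq (by ring)) ?_
  rcases hqa with hq | hq
  · refine mul_le_mul_of_nonpos_right (hx.trans (by gcongr)) ?_
    have hd : 1 - 2 * t = (1 - 2 * a) * (1 - 2 * p) := by rw [ht]; unfold binConv; ring
    rcases le_total p (1 / 2) with h | h
    · refine mul_nonpos_of_nonneg_of_nonpos (by linarith) ?_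
      have : 0 ≤ (1 - 2 * a) * (1 - 2 * p) := mul_nonneg (by linarith) (by linarith)
      exact sub_nonpos.2 (Real.log_le_log ht0 (by linarith))
    · refine mul_nonpos_of_nonpos_of_nonneg (by linarith) ?_
      have : 0 ≤ (1 - 2 * a) * (2 * p - 1) := mul_nonneg (by linarith) (by linarith)
      exact sub_nonneg.2 (Real.log_le_log (by linarith) (by linarith))
  · have : t = 2⁻¹ := by rw [ht, hq, binConv_half]
    rw [this]
    norm_num

/-- Fano-type bound for a code with input constraint on the binary symmetric channel; `δ` is a
free parameter. -/
theorem bsc_fano {p q a δ : ℝ} (hp : p ∈ Set.Icc (0 : ℝ) 1) (ha0 : 0 < a)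
    (ha1 : a ≤ 1 / 2) (hqa : q ≤ a ∨ a = 1 / 2) (hδ0 : 0 < δ) (hδ1 : δ < 1) {n M : ℕ} (hM : 0 < M)
    (x : Fin M → Fin n → ZMod 2) (hx : ∀ w, ∑ i, ((x w i).val : ℝ) ≤ n * q)
    (dec : (Fin n → ZMod 2) → Fin M) {e : ℝ}
    (he : e = 1 / (M : ℝ) * ∑ w, ∑ z : Fin n → ZMod 2,
      (∏ i, bern p (z i)) * (if dec (x w + z) = w then 0 else 1)) :
    (1 - e) * Real.log M ≤
      n * bscInfo a p + (1 - e) * -Real.log (1 - δ) + e * -Real.log δ := by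
  set t := binConv a p with ht
  have ht0 : 0 < t := binConv_pos ha0 (by linarith) hp
  have ht1 : t < 1 := binConv_lt_one ha0 (by linarith) hp
  have hMR : (0 : ℝ) < M := by exact_mod_cast hM
  have hbp : bern p ∈ stdSimplex ℝ (ZMod 2) := bern_mem hp
  have hpz : ∀ z : Fin n → ZMod 2, 0 ≤ ∏ i, bern p (z i) := fun z =>
    Finset.prod_nonneg fun i _ => hbp.1 _
  have hp1 : ∑ z : Fin n → ZMod 2, ∏ i, bern p (z i) = 1 := sum_prod_pmf_eq_one fun _ => hbp.2
  have hQ1 : ∑ z : Fin n → ZMod 2, ∏ i, bern t (z i) = 1 :=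
    sum_prod_pmf_eq_one fun _ => (bern_mem ⟨ht0.le, ht1.le⟩).2
  have hQ0 : ∀ z : Fin n → ZMod 2, 0 < ∏ i, bern t (z i) := fun z =>
    Finset.prod_pos fun i _ => bern_pos ht0 ht1 _
  let P : Fin M × (Fin n → ZMod 2) → ℝ := fun ω => 1 / (M : ℝ) * ∏ i, bern p (ω.2 i)
  -- Guessing kernel of the test law: `1 - δ` on the decoded message and `δ / M` on each other one,
  -- hence total mass at most 1 for every output. The test law `R` multiplies it by the product
  -- output law.
  let k : Fin M × (Fin n → ZMod 2) → ℝ := fun ω =>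
    if dec (x ω.1 + ω.2) = ω.1 then 1 - δ else δ / M
  let R : Fin M × (Fin n → ZMod 2) → ℝ := fun ω => (∏ i, bern t ((x ω.1 + ω.2) i)) * k ω
  have hk : ∀ ω, 0 < k ω := fun ω => by
    simp only [k]; split_ifs
    · linarith
    · positivity
  have hP : P ∈ stdSimplex ℝ _ := by
    refine ⟨fun ω => mul_nonneg (by positivity) (hpz _), ?_⟩
    rw [Fintype.sum_prod_type]
    simp only [P, ← Finset.mul_sum, hp1]
    simp only [mul_one, Finset.sum_const, Finset.card_univ, Fintype.card_fin, nsmul_eq_mul]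
    field_simp
  have hR : ∀ ω, 0 < R ω := fun ω => mul_pos (hQ0 _) (hk ω)
  have hR1 : ∑ ω, R ω ≤ 1 := by
    rw [Fintype.sum_prod_type]
    have h1 : ∀ w, ∑ z, R (w, z) = ∑ y : Fin n → ZMod 2, (∏ i, bern t (y i)) *
        (if dec y = w then 1 - δ else δ / M) := fun w =>
      Fintype.sum_equiv (Equiv.addLeft (x w)) _ _ fun z => rfl
    simp only [h1]
    rw [Finset.sum_comm]
    simp only [← Finset.mul_sum]
    refine le_of_le_of_eq ?_ hQ1
    refine Finset.sum_le_sum fun y _ => mul_le_of_le_one_right (hQ0 y).le ?_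
    calc ∑ w, (if dec y = w then 1 - δ else δ / M)
        ≤ ∑ w, ((if dec y = w then 1 - δ else 0) + δ / M) := by
          refine Finset.sum_le_sum fun w _ => ?_
          have : 0 ≤ δ / M := by positivity
          split_ifs <;> linarith
      _ = 1 := by
          rw [Finset.sum_add_distrib]
          simp only [Finset.sum_ite_eq, Finset.mem_univ, if_true, Finset.sum_const,
            Finset.card_univ, Fintype.card_fin, nsmul_eq_mul]
          field_simp
          ring
  have hG := sum_mul_log_le_sum_mul_log hP hR hR1
  have hPP : ∑ ω, P ω * Real.log (P ω) = -Real.log M - n * Real.binEntropy p := by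
    have h1 : ∀ ω, P ω * Real.log (P ω) = 1 / (M : ℝ) * ((∏ i, bern p (ω.2 i)) * -Real.log M
        + (∏ i, bern p (ω.2 i)) * Real.log (∏ i, bern p (ω.2 i))) := by
      intro ω
      simp only [P]
      by_cases hz : ∏ i, bern p (ω.2 i) = 0
      · simp [hz]
      · rw [Real.log_mul (by positivity) hz, one_div, Real.log_inv]; ring
    simp only [h1]
    rw [Fintype.sum_prod_type]
    simp only [← Finset.mul_sum, Finset.sum_add_distrib, ← Finset.sum_mul, hp1,
      sum_prod_mul_log_prod hbp, sum_bern_mul_log_bern]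
    simp only [Finset.sum_const, Finset.card_univ, Fintype.card_fin, nsmul_eq_mul]
    field_simp
    ring
  have hPR : -(n * Real.binEntropy t) + (1 - e) * Real.log (1 - δ) + e * (Real.log δ - Real.log M)
      ≤ ∑ ω, P ω * Real.log (R ω) := by
    have h1 : ∀ ω, P ω * Real.log (R ω) =
        1 / (M : ℝ) * ((∏ i, bern p (ω.2 i)) * ∑ i, Real.log (bern t (x ω.1 i + ω.2 i)))
        + (1 / (M : ℝ) * ((∏ i, bern p (ω.2 i)) * Real.log (1 - δ))
        + 1 / (M : ℝ) * ((∏ i, bern p (ω.2 i)) * (if dec (x ω.1 + ω.2) = ω.1 then 0 else 1))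
          * (Real.log δ - Real.log M - Real.log (1 - δ))) := by
      intro ω
      simp only [P, R]
      rw [Real.log_mul (hQ0 _).ne' (hk ω).ne',
        Real.log_prod (fun i _ => (bern_pos ht0 ht1 _).ne')]
      -- Written through the error indicator, so that taking expectations produces `e`.
      have h2 : Real.log (k ω) = Real.log (1 - δ) + (if dec (x ω.1 + ω.2) = ω.1 then 0 else 1)
          * (Real.log δ - Real.log M - Real.log (1 - δ)) := by
        simp only [k]
        split_ifs
        · ring
        · rw [Real.log_div hδ0.ne' hMR.ne']; ring
      rw [h2]
      simp only [Pi.add_apply]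
      ring
    simp only [h1]
    rw [Fintype.sum_prod_type]
    simp only [Finset.sum_add_distrib, ← Finset.mul_sum, ← Finset.sum_mul, ← he, hp1]
    have h3 : -(n * Real.binEntropy t) ≤ 1 / (M : ℝ) * ∑ w, ∑ z : Fin n → ZMod 2,
        (∏ i, bern p (z i)) * ∑ i, Real.log (bern t (x w i + z i)) := by
      have h4 : ∀ w, -(n * Real.binEntropy t) ≤ ∑ z : Fin n → ZMod 2,
          (∏ i, bern p (z i)) * ∑ i, Real.log (bern t (x w i + z i)) := fun w => by
        rw [sum_prod_mul_sum (fun _ => hbp.2) (fun i a => Real.log (bern t (x w i + a)))]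
        exact neg_mul_binEntropy_le_sum hp ha0 ha1 hqa (x w) (hx w)
      have h5 := Finset.sum_le_sum fun w (_ : w ∈ Finset.univ) => h4 w
      simp only [Finset.sum_const, Finset.card_univ, Fintype.card_fin, nsmul_eq_mul] at h5
      rw [one_div, ← div_eq_inv_mul, le_div_iff₀ hMR]
      linarith
    simp only [Finset.sum_const, Finset.card_univ, Fintype.card_fin, nsmul_eq_mul]
    have h6 : 1 / (M : ℝ) * (1 * (M * Real.log (1 - δ))) = Real.log (1 - δ) := by field_simp
    rw [h6]
    linarith
  unfold bscInfo
  linarith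

end Converse

/-! ### Random coding for the symmetric channel. -/

section Achievability

/-- Coding for the binary symmetric channel with a constraint on the number of ones. -/
theorem eventually_exists_bsc_code {p q a ρ ε : ℝ} (hp : p ∈ Set.Icc (0 : ℝ) 1) (ha0 : 0 < a)
    (ha1 : a < 1) (haq : a < q) (hρ : ρ < bscInfo a p) (hε0 : 0 < ε) :
    ∀ᶠ m : ℕ in Filter.atTop, ∀ M : ℕ, 0 < M → M * Real.exp (-(m * ρ)) < ε →
      ∃ (c : Fin M → Fin m → ZMod 2) (dec : (Fin m → ZMod 2) → Fin M),
        ∀ w, ∑ i, ((c w i).val : ℝ) ≤ m * q ∧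
          ∑ z : Fin m → ZMod 2, (∏ i, bern p (z i)) * (if dec (c w + z) = w then 0 else 1)
            ≤ 3 * ε := by
  classical
  set t := binConv a p with ht
  have ht0 : 0 < t := binConv_pos ha0 ha1 hp
  have ht1 : t < 1 := binConv_lt_one ha0 ha1 hp
  have hbp : bern p ∈ stdSimplex ℝ (ZMod 2) := bern_mem hp
  have hba : bern a ∈ stdSimplex ℝ (ZMod 2) := bern_mem ⟨ha0.le, ha1.le⟩
  have hbs : ∀ x : ZMod 2, ∑ y, bern p (y - x) = 1 := fun x => by
    rw [← hbp.2]
    exact Fintype.sum_equiv (Equiv.subRight x) _ _ (fun y => rfl)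
  let μ : ZMod 2 × ZMod 2 → ℝ := fun u => bern a u.1 * bern p (u.2 - u.1)
  -- Information density of one letter, with mean `bscInfo a p`.
  let g : ZMod 2 × ZMod 2 → ℝ := fun u =>
    Real.log (bern p (u.2 - u.1)) - Real.log (bern t u.2)
  have hμ : μ ∈ stdSimplex ℝ (ZMod 2 × ZMod 2) := by
    refine ⟨fun u => mul_nonneg (hba.1 _) (hbp.1 _), ?_⟩
    rw [Fintype.sum_prod_type]
    simp only [μ, ← Finset.mul_sum, hbs, mul_one, hba.2]
  have hmean : ∑ u, μ u * g u = bscInfo a p := by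
    rw [Fintype.sum_prod_type]
    simp only [μ, g, sum_zmod_two, bern_zero, bern_one, sub_self, sub_zero,
      show (0 - 1 : ZMod 2) = 1 from by decide]
    simp only [bscInfo, ← ht, binEntropy_eq_neg]
    have : t = a * (1 - p) + (1 - a) * p := ht
    linear_combination (Real.log t - Real.log (1 - t)) * this
  set V₁ := ∑ u, bern a u * (((u.val : ℕ) : ℝ) - ∑ v, bern a v * ((v.val : ℕ) : ℝ)) ^ 2 with hV₁
  set V₂ := ∑ u, μ u * (g u - ∑ v, μ v * g v) ^ 2 with hV₂
  have hlim : ∀ V d : ℝ, 0 < d → ∀ᶠ m : ℕ in Filter.atTop, m * V / (m * d) ^ 2 < ε := by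
    intro V d hd
    have h1 : Filter.Tendsto (fun m : ℕ => (V / d ^ 2) / (m : ℝ)) Filter.atTop (nhds 0) :=
      tendsto_const_div_atTop_nhds_zero_nat _
    filter_upwards [h1.eventually_lt_const hε0, Filter.eventually_gt_atTop 0] with m hm hm0
    refine lt_of_eq_of_lt ?_ hm
    have : (m : ℝ) ≠ 0 := by exact_mod_cast hm0.ne'
    field_simp
  filter_upwards [hlim V₁ (q - a) (by linarith), hlim V₂ (bscInfo a p - ρ) (by linarith),
    Filter.eventually_gt_atTop 0] with m hm1 hm2 hm0 M hM0 hM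
  -- Feinstein's lemma needs an error level of at most 1. Above that level the all-zero codebook
  -- suffices.
  by_cases hε1 : 1 < 3 * ε
  · refine ⟨fun _ _ => 0, fun _ => ⟨0, hM0⟩, fun w => ⟨?_, ?_⟩⟩
    · simp only [ZMod.val_zero, Nat.cast_zero, Finset.sum_const_zero]
      have : 0 < q := ha0.trans haq
      positivity
    · refine le_trans ?_ hε1.le
      refine le_of_le_of_eq ?_ (sum_prod_pmf_eq_one (n := m) fun _ => hbp.2)
      refine Finset.sum_le_sum fun z _ => ?_
      exact mul_le_of_le_one_right (Finset.prod_nonneg fun i _ => hbp.1 _)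
        (by split_ifs <;> norm_num)
  have hmR : (0 : ℝ) < m := by exact_mod_cast hm0
  let P : (Fin m → ZMod 2) → ℝ := fun x => ∏ i, bern a (x i)
  let W : (Fin m → ZMod 2) → (Fin m → ZMod 2) → ℝ := fun x y => ∏ i, bern p (y i - x i)
  -- Outputs whose information density with `x` exceeds `m ρ`. The output law then gives `B x` mass
  -- at most `exp (-(m ρ))`, whatever `x` is.
  let B : (Fin m → ZMod 2) → Finset (Fin m → ZMod 2) := fun x =>
    {y | Real.exp (m * ρ) * ∏ i, bern t (y i) < W x y}
  have hP : P ∈ stdSimplex ℝ (Fin m → ZMod 2) :=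
    ⟨fun x => Finset.prod_nonneg fun i _ => hba.1 _, sum_prod_pmf_eq_one fun _ => hba.2⟩
  have hW : ∀ x, W x ∈ stdSimplex ℝ (Fin m → ZMod 2) := fun x =>
    ⟨fun y => Finset.prod_nonneg fun i _ => hbp.1 _,
      sum_prod_pmf_eq_one (f := fun i b => bern p (b - x i)) fun i => hbs (x i)⟩
  have hPW : ∀ y, ∑ x, P x * W x y = ∏ i, bern t (y i) := by
    intro y
    simp only [P, W, ← Finset.prod_mul_distrib]
    have h := Finset.prod_univ_sum (fun _ : Fin m => (Finset.univ : Finset (ZMod 2)))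
      (fun i b => bern a b * bern p (y i - b))
    rw [Fintype.piFinset_univ] at h
    rw [← h]
    simp only [sum_bern_mul_bern_sub, ht]
  have hB : ∀ x, ∑ y ∈ B x, ∑ x', P x' * W x' y ≤ Real.exp (-(m * ρ)) := by
    intro x
    simp only [hPW]
    calc ∑ y ∈ B x, ∏ i, bern t (y i) ≤ ∑ y ∈ B x, Real.exp (-(m * ρ)) * W x y := by
          refine Finset.sum_le_sum fun y hy => ?_
          have hy' : Real.exp (m * ρ) * ∏ i, bern t (y i) < W x y := by simpa [B] using hy
          rw [Real.exp_neg, inv_mul_eq_div, le_div_iff₀ (Real.exp_pos _)]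
          linarith
      _ ≤ ∑ y, Real.exp (-(m * ρ)) * W x y :=
          Finset.sum_le_sum_of_subset_of_nonneg (Finset.subset_univ _) fun y _ _ =>
            mul_nonneg (Real.exp_pos _).le ((hW x).1 y)
      _ = Real.exp (-(m * ρ)) := by rw [← Finset.mul_sum, (hW x).2, mul_one]
  let G : (Fin m → ZMod 2) → Prop := fun x => ∑ i, ((x i).val : ℝ) ≤ m * q
  have hbad1 : ∑ x, P x * (if G x then 0 else 1) < ε := by
    refine lt_of_le_of_lt ?_ hm1
    have h := sum_prod_ite_le_of_dev hba (fun u => ((u.val : ℕ) : ℝ)) m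
      (d := m * (q - a)) (mul_pos hmR (by linarith)) (fun x => ¬ G x) ?_
    · refine le_of_eq_of_le (Finset.sum_congr rfl fun x _ => ?_) h
      by_cases hx : G x <;> simp [hx, P]
    · intro z _ hz
      have h1 : ∑ v, bern a v * ((v.val : ℕ) : ℝ) = a := by
        rw [sum_zmod_two]
        simp [ZMod.val_one]
      rw [h1]
      have h2 : m * q < ∑ i, ((z i).val : ℝ) := not_le.1 hz
      refine le_trans ?_ (le_abs_self _)
      linarith
  have hbad2 : ∑ x, ∑ y, P x * W x y * (if y ∈ B x then 0 else 1) < ε := by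
    refine lt_of_le_of_lt ?_ hm2
    have h := sum_prod_ite_le_of_dev hμ g m
      (d := m * (bscInfo a p - ρ)) (mul_pos hmR (by linarith))
      (fun u => (fun i => (u i).2) ∉ B (fun i => (u i).1)) ?_
    · refine le_of_eq_of_le ?_ h
      rw [← Fintype.sum_prod_type' (f := fun x y => P x * W x y * (if y ∈ B x then 0 else 1))]
      refine (Fintype.sum_equiv (Equiv.arrowProdEquivProdArrow (Fin m) (fun _ => ZMod 2)
        (fun _ => ZMod 2)) _ _ fun u => ?_).symm
      simp only [μ, Finset.prod_mul_distrib, P, W, Equiv.arrowProdEquivProdArrow,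
        Equiv.coe_fn_mk]
      congr 1
      split_ifs <;> simp_all
    · intro u hu hE
      rw [hmean]
      have hE' : W (fun i => (u i).1) (fun i => (u i).2) ≤
          Real.exp (m * ρ) * ∏ i, bern t (u i).2 := by
        simpa [B] using hE
      have hu' : ∀ i, bern p ((u i).2 - (u i).1) ≠ 0 := fun i h0 =>
        hu (Finset.prod_eq_zero (Finset.mem_univ i) (by simp [μ, h0]))
      have hlog := Real.log_le_log (Finset.prod_pos fun i _ =>
        lt_of_le_of_ne (hbp.1 _) (hu' i).symm) hE'
      rw [Real.log_mul (Real.exp_pos _).ne'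
        (Finset.prod_pos fun i _ => bern_pos ht0 ht1 _).ne', Real.log_exp,
        Real.log_prod (fun i _ => hu' i),
        Real.log_prod (fun i _ => (bern_pos ht0 ht1 _).ne')] at hlog
      refine le_trans ?_ (neg_le_abs _)
      simp only [g, Finset.sum_sub_distrib]
      linarith
  -- The level `3 ε` collects `M β`, the probability of a codeword that is too heavy, and the
  -- probability of a low information density.
  obtain ⟨c, dec, hc⟩ := exists_code_of_sum_lt hP hW B (Real.exp_pos _).le hB G
    (ε := 3 * ε) (not_lt.1 hε1) M hM0 (by
      refine lt_of_le_of_lt (add_le_add (le_refl _) (?_ : _ ≤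
          ∑ x, P x * (if G x then 0 else 1) + ∑ x, ∑ y, P x * W x y *
            (if y ∈ B x then 0 else 1))) (by linarith)
      · rw [← Finset.sum_add_distrib]
        refine Finset.sum_le_sum fun x _ => ?_
        have h1 : P x * (if G x then 0 else 1) = ∑ y, P x * W x y * (if G x then 0 else 1) := by
          rw [← Finset.sum_mul, ← Finset.mul_sum, (hW x).2, mul_one]
        rw [h1, ← Finset.sum_add_distrib]
        refine Finset.sum_le_sum fun y _ => ?_
        rw [← mul_add]
        refine mul_le_mul_of_nonneg_left ?_ (mul_nonneg (hP.1 x) ((hW x).1 y))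
        by_cases h1 : G x <;> by_cases h2 : y ∈ B x <;> simp [h1, h2])
  refine ⟨c, dec, fun w => ⟨(hc w).1, le_of_eq_of_le ?_ (hc w).2⟩⟩
  refine Fintype.sum_equiv (Equiv.addLeft (c w)) _ _ fun z => ?_
  simp only [Equiv.coe_addLeft, W, Pi.add_apply, add_sub_cancel_left]
  congr 1

end Achievability

/-! ### Converse for the multiple access channel. -/

section BinaryMAC

variable {p q₁ q₂ : ℝ}

-- Change of variables from outputs to noise. The second output component is deterministic, so its
-- indicator collapses the sum over that component.
open Classical in
theorem errorProb_binaryMAC (hp : p ∈ Set.Icc (0 : ℝ) 1) {Mc M n : ℕ}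
    (c : MACCode (ZMod 2) (ZMod 2) (ZMod 2) (ZMod 2 × ZMod 2) Mc M n) :
    c.errorProb (binaryMAC p hp) = (1 / ((Mc : ℝ) * (M : ℝ))) *
      ∑ wc, ∑ w, ∑ s : Fin n → ZMod 2, (∏ i, bern (1 / 2) (s i)) *
        ∑ z : Fin n → ZMod 2, (∏ i, bern p (z i)) *
          (if c.dec (fun i => (c.enc₁ wc w s i + s i + z i, c.word₂ wc s i)) = (wc, w)
            then 0 else 1) := by
  unfold MACCode.errorProb
  congr 1
  refine Finset.sum_congr rfl fun wc _ => Finset.sum_congr rfl fun w _ =>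
    Finset.sum_congr rfl fun s _ => ?_
  congr 1
  rw [Fintype.sum_equiv (Equiv.arrowProdEquivProdArrow (Fin n) (fun _ => ZMod 2)
    (fun _ => ZMod 2)) _ (fun u => (∏ i, bern p (u.1 i - c.enc₁ wc w s i - s i)) *
      (if c.dec (fun i => (u.1 i, u.2 i)) = (wc, w) then 0 else 1) *
        (if u.2 = c.word₂ wc s then 1 else 0))]
  · rw [Fintype.sum_prod_type]
    simp only [mul_ite, mul_one, mul_zero, Finset.sum_ite_eq', Finset.mem_univ, if_true]
    refine (Fintype.sum_equiv (Equiv.addLeft (fun i => c.enc₁ wc w s i + s i)) _ _ fun z => ?_).symm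
    simp only [Equiv.coe_addLeft, Pi.add_apply]
    simp only [sub_sub, add_sub_cancel_left]
  · intro y
    change _ = (∏ i, bern p ((y i).1 - c.enc₁ wc w s i - s i)) *
      (if c.dec y = (wc, w) then 0 else 1) *
        (if (fun i => (y i).2) = c.word₂ wc s then 1 else 0)
    simp only [binaryMAC, Finset.prod_mul_distrib, Finset.prod_boole, Finset.mem_univ, true_implies, funext_iff]
    by_cases h : c.dec y = (wc, w)
    · rw [if_pos h, if_pos h]; simp
    · rw [if_neg h, if_neg h]; simp

/-- Fano's inequality for codes on the binary example. -/
theorem log_card_le_of_errorProb_le (hp : p ∈ Set.Icc (0 : ℝ) 1) {a δ : ℝ} (ha0 : 0 < a)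
    (ha1 : a ≤ 1 / 2) (hqa : q₁ ≤ a ∨ a = 1 / 2) (hδ0 : 0 < δ) (hδ1 : δ ≤ 1 / 2) {Mc M n : ℕ}
    (hMc : Mc = 1) (hM : 0 < M)
    (c : MACCode (ZMod 2) (ZMod 2) (ZMod 2) (ZMod 2 × ZMod 2) Mc M n)
    (hc : c.WeightConstrained q₁ q₂) (he : c.errorProb (binaryMAC p hp) ≤ δ) :
    (1 - δ) * Real.log M ≤ n * bscInfo a p + Real.binEntropy δ := by
  classical
  subst hMc
  -- Decoder with the state `s` revealed: from `u = x₁ + z` it can rebuild the whole channel output.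
  let D : (Fin n → ZMod 2) → (Fin n → ZMod 2) → Fin M := fun s u =>
    (c.dec (fun i => (u i + s i, c.word₂ 0 s i))).2
  let e : (Fin n → ZMod 2) → ℝ := fun s => 1 / (M : ℝ) * ∑ w, ∑ z : Fin n → ZMod 2,
    (∏ i, bern p (z i)) * (if D s (c.enc₁ 0 w s + z) = w then 0 else 1)
  have hQ : bern (1 / 2) ∈ stdSimplex ℝ (ZMod 2) := bern_mem (by norm_num)
  have hQ1 : ∑ s : Fin n → ZMod 2, ∏ i, bern (1 / 2) (s i) = 1 :=
    sum_prod_pmf_eq_one fun _ => hQ.2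
  have hfano : ∀ s, (1 - e s) * Real.log M ≤
      n * bscInfo a p + (1 - e s) * -Real.log (1 - δ) + e s * -Real.log δ := fun s =>
    bsc_fano hp ha0 ha1 hqa hδ0 (by linarith) hM (fun w => c.enc₁ 0 w s)
      (fun w => hc.1 0 w s) (D s) rfl
  have herr : c.errorProb (binaryMAC p hp) = ∑ s, (∏ i, bern (1 / 2) (s i)) * e s := by
    rw [errorProb_binaryMAC]
    simp only [Fin.sum_univ_one, Fin.isValue, Nat.cast_one, one_mul]
    rw [Finset.sum_comm]
    simp only [← Finset.mul_sum]
    rw [Finset.mul_sum]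
    refine Finset.sum_congr rfl fun s _ => ?_
    simp only [e]
    rw [mul_left_comm]
    congr 2
    refine Finset.sum_congr rfl fun w _ => Finset.sum_congr rfl fun z _ => ?_
    congr 1
    refine if_congr ?_ rfl rfl
    rw [Prod.ext_iff]
    simp only [D, Pi.add_apply, add_right_comm, Subsingleton.elim _ (0 : Fin 1), true_and]
  -- The Fano bound is affine in `e s` because `δ` does not depend on `s`, so averaging over states
  -- leaves only the overall error probability. With `δ ≤ 1/2` the bound is increasing in that
  -- probability, which may be replaced by `δ`.
  have hs := Finset.sum_le_sum fun s (_ : s ∈ Finset.univ) =>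
    mul_le_mul_of_nonneg_left (hfano s)
      (Finset.prod_nonneg fun i (_ : i ∈ Finset.univ) => hQ.1 (s i))
  simp only [sub_mul, one_mul, mul_add, mul_sub, Finset.sum_add_distrib, Finset.sum_sub_distrib,
    ← mul_assoc, ← Finset.sum_mul, ← herr, hQ1] at hs
  have hlog : Real.log δ ≤ Real.log (1 - δ) := Real.log_le_log hδ0 (by linarith)
  have hlogM : 0 ≤ Real.log M := Real.log_natCast_nonneg M
  rw [binEntropy_eq_neg]
  nlinarith [mul_le_mul_of_nonneg_right he hlogM,
    mul_le_mul_of_nonneg_right he (sub_nonneg.2 hlog)]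

/-- Common rate 0 means a single common message. The count appears as a ceiling, which is why the
code lemmas take the equation `Mc = 1` as a hypothesis. -/
theorem ceil_two_rpow_mul_zero (n : ℕ) : ⌈(2 : ℝ) ^ ((n : ℝ) * 0)⌉₊ = 1 := by
  simp

theorem ceil_two_rpow_pos (x : ℝ) : 0 < ⌈(2 : ℝ) ^ x⌉₊ :=
  Nat.ceil_pos.2 (Real.rpow_pos_of_pos (by norm_num) x)

theorem StateMAC.Achievable.rate_mul_log_two_le (hp : p ∈ Set.Icc (0 : ℝ) 1) {a R : ℝ}
    (ha0 : 0 < a) (ha1 : a ≤ 1 / 2) (hqa : q₁ ≤ a ∨ a = 1 / 2)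
    (hR : (binaryMAC p hp).Achievable q₁ q₂ 0 R) : R * Real.log 2 ≤ bscInfo a p := by
  have key : ∀ δ : ℝ, 0 < δ → δ ≤ 1 / 2 →
      (1 - δ) * (R * Real.log 2) ≤ bscInfo a p + Real.binEntropy δ := by
    intro δ hδ0 hδ1
    obtain ⟨n, hn, c, hc, he⟩ := hR.2.2 δ hδ0
    have h := log_card_le_of_errorProb_le hp ha0 ha1 hqa hδ0 hδ1 (ceil_two_rpow_mul_zero n)
      (ceil_two_rpow_pos _) c hc he
    have hM : n * (R * Real.log 2) ≤ Real.log (⌈(2 : ℝ) ^ ((n : ℝ) * R)⌉₊ : ℝ) := by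
      rw [← mul_assoc, ← Real.log_rpow (by norm_num)]
      exact Real.log_le_log (Real.rpow_pos_of_pos (by norm_num) _) (Nat.le_ceil _)
    have hn1 : (1 : ℝ) ≤ n := by exact_mod_cast hn
    have hH : 0 ≤ Real.binEntropy δ := Real.binEntropy_nonneg hδ0.le (by linarith)
    have h1 : (1 - δ) * (n * (R * Real.log 2)) ≤ n * bscInfo a p + Real.binEntropy δ :=
      (mul_le_mul_of_nonneg_left hM (by linarith)).trans h
    -- Achievability only supplies some `n ≥ 1`, possibly small, so the entropy term is absorbed
    -- using `1 ≤ n` and removed by letting `δ → 0`.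
    have h2 : Real.binEntropy δ ≤ n * Real.binEntropy δ := le_mul_of_one_le_left hH hn1
    refine le_of_mul_le_mul_left ?_ (lt_of_lt_of_le one_pos hn1)
    linarith
  have hl : Filter.Tendsto (fun δ : ℝ => (1 - δ) * (R * Real.log 2))
      (nhdsWithin 0 (Set.Ioi 0)) (nhds ((1 - 0) * (R * Real.log 2))) :=
    (Continuous.tendsto (by fun_prop) 0).mono_left nhdsWithin_le_nhds
  have hr : Filter.Tendsto (fun δ : ℝ => bscInfo a p + Real.binEntropy δ)
      (nhdsWithin 0 (Set.Ioi 0)) (nhds (bscInfo a p + Real.binEntropy 0)) :=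
    (Continuous.tendsto (by fun_prop) 0).mono_left nhdsWithin_le_nhds
  have := le_of_tendsto_of_tendsto hl hr (by
    filter_upwards [Ioc_mem_nhdsGT (show (0 : ℝ) < 1 / 2 by norm_num)] with δ hδ
    exact key δ hδ.1 hδ.2)
  simpa using this

/-- Converse. -/
theorem StateMAC.Achievable.rate_le (hp : p ∈ Set.Icc (0 : ℝ) 1) (hq₁ : 0 ≤ q₁) {R : ℝ}
    (hR : (binaryMAC p hp).Achievable q₁ q₂ 0 R) :
    R ≤ bscInfo (min q₁ (1 / 2)) p / Real.log 2 := by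
  rw [le_div_iff₀ (Real.log_pos (by norm_num))]
  rcases le_or_gt (1 / 2) q₁ with h | h
  · rw [min_eq_right h]
    exact hR.rate_mul_log_two_le hp (by norm_num) le_rfl (Or.inr rfl)
  · rw [min_eq_left h.le]
    -- Since `q₁ = 0` is allowed while the test input must be positive, the bound is taken at `a >
    -- q₁` and `a` decreases to `q₁`.
    refine ge_of_tendsto (((continuous_bscInfo p).tendsto q₁).mono_left
      (nhdsWithin_le_nhds (s := Set.Ioi q₁))) ?_
    filter_upwards [Ioc_mem_nhdsGT h] with a ha
    exact hR.rate_mul_log_two_le hp (hq₁.trans_lt ha.1) ha.2 (Or.inl ha.1.le)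

end BinaryMAC

/-! ### Relaying the state with unit delay under a hard weight constraint. -/

section StateRelay

/-- Delaying a sequence by one step, with transmission stopped once more than half of the budget
`n` has been used, keeps the total within half of the budget. -/
theorem two_mul_sum_delayed_le (u : ℕ → ℕ) (n k : ℕ) :
    2 * ∑ i ∈ Finset.range k, (if 0 < i ∧ 2 * ∑ j ∈ Finset.range i, u j ≤ n then u (i - 1) else 0)
        ≤ n ∧
      ∑ i ∈ Finset.range k, (if 0 < i ∧ 2 * ∑ j ∈ Finset.range i, u j ≤ n then u (i - 1) else 0)
        ≤ ∑ j ∈ Finset.range (k - 1), u j := by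
  induction k with
  | zero => simp
  | succ k ih =>
    rw [Finset.sum_range_succ]
    -- The second bound drives the induction: when `u (i - 1)` is sent, the total sent is at most `∑
    -- j < i, u j`, which the stopping test has just found to be at most `n / 2`.
    obtain ⟨h1, h2⟩ := ih
    cases k with
    | zero => simp
    | succ k =>
      simp only [Nat.add_sub_cancel] at h2 ⊢
      have h3 := Finset.sum_range_succ u k
      split_ifs with hc
      · have := hc.2
        omega
      · omega

/-- Block code in which Encoder 1 ignores the state and sends a codeword of length `m` followed by
`k` zeros, and Encoder 2 relays the state with unit delay as long as the number of ones in the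
state does not exceed half of the block length. -/
def stateRelayCode {m k M Mc : ℕ} (hk : 0 < k) (c : Fin M → Fin m → ZMod 2)
    (dec : (Fin m → ZMod 2) → Fin M) (wc : Fin Mc) :
    MACCode (ZMod 2) (ZMod 2) (ZMod 2) (ZMod 2 × ZMod 2) Mc M (m + k) where
  enc₁ _ w _ := Fin.append (c w) (fun _ => 0)
  enc₂ i _ s := if h : 0 < (i : ℕ) ∧ 2 * ∑ j, (s j).val ≤ m + k then
    s ⟨(i : ℕ) - 1, Nat.sub_lt h.1 one_pos⟩ else 0
  -- State `j` arrives at time `j + 1`, which lies inside the block because `0 < k`. Subtracting it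
  -- leaves the codeword plus noise.
  dec y := (wc, dec fun j => (y (Fin.castAdd k j)).1 - (y ⟨(j : ℕ) + 1, by omega⟩).2)

variable {m k M Mc : ℕ} (hk : 0 < k) (c : Fin M → Fin m → ZMod 2)
  (dec : (Fin m → ZMod 2) → Fin M) (wc : Fin Mc)

theorem two_mul_sum_word₂_stateRelayCode_le (wc' : Fin Mc) (s : Fin (m + k) → ZMod 2) :
    2 * ∑ i, ((stateRelayCode hk c dec wc).word₂ wc' s i).val ≤ m + k := by
  let u : ℕ → ℕ := fun j => if h : j < m + k then (s ⟨j, h⟩).val else 0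
  refine le_of_eq_of_le ?_ (two_mul_sum_delayed_le u (m + k) (m + k)).1
  rw [Finset.sum_range]
  congr 1
  refine Finset.sum_congr rfl fun i _ => ?_
  have hsum : ∑ j ∈ Finset.range (i : ℕ), u j =
      ∑ j : Fin (i : ℕ), (s (Fin.castLE i.isLt.le j)).val := by
    rw [Finset.sum_range]
    refine Finset.sum_congr rfl fun j _ => ?_
    simp only [u]
    rw [dif_pos (j.isLt.trans i.isLt)]
    rfl
  rw [hsum]
  simp only [MACCode.word₂, stateRelayCode]
  split_ifs with h
  · simp only [u]
    rw [dif_pos (by omega)]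
    rfl
  · simp

/-- Each stopping test up to time `m` involves only the first `m` states, so a bound on their total
weight makes all these tests pass. -/
theorem word₂_stateRelayCode (wc' : Fin Mc) (s : Fin (m + k) → ZMod 2)
    (hs : 2 * ∑ j : Fin m, (s (Fin.castAdd k j)).val ≤ m + k) (j : Fin m) :
    (stateRelayCode hk c dec wc).word₂ wc' s ⟨(j : ℕ) + 1, by omega⟩ = s (Fin.castAdd k j) := by
  simp only [MACCode.word₂, stateRelayCode]
  rw [dif_pos]
  · rfl
  · refine ⟨Nat.succ_pos _, le_trans (Nat.mul_le_mul_left 2 ?_) hs⟩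
    have h : ∀ x : Fin ((j : ℕ) + 1), (x : ℕ) < m := fun x => by omega
    calc _ = ∑ x : Fin ((j : ℕ) + 1), (s (Fin.castAdd k (Fin.castLE (by omega) x))).val := rfl
      _ = ∑ x ∈ Finset.univ.map (Fin.castLEEmb (show (j : ℕ) + 1 ≤ m by omega)),
          (s (Fin.castAdd k x)).val := by rw [Finset.sum_map]; rfl
      _ ≤ _ := Finset.sum_le_sum_of_subset (Finset.subset_univ _)

theorem weightConstrained_stateRelayCode {q₁ q₂ : ℝ} (hq₁ : 0 ≤ q₁) (hq₂ : 1 / 2 ≤ q₂)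
    (hc : ∀ w, ∑ i, ((c w i).val : ℝ) ≤ m * q₁) :
    (stateRelayCode hk c dec wc).WeightConstrained q₁ q₂ := by
  refine ⟨fun _ w _ => ?_, fun wc' s => ?_⟩
  · simp only [stateRelayCode, Fin.sum_univ_add, Fin.append_left, Fin.append_right,
      ZMod.val_zero, Nat.cast_zero, Finset.sum_const_zero, add_zero]
    refine (hc w).trans (mul_le_mul_of_nonneg_right ?_ hq₁)
    push_cast
    linarith [(Nat.cast_nonneg k : (0 : ℝ) ≤ k)]
  · have h : (2 : ℝ) * ∑ i, (((stateRelayCode hk c dec wc).word₂ wc' s i).val : ℝ) ≤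
        ((m + k : ℕ) : ℝ) := by
      exact_mod_cast two_mul_sum_word₂_stateRelayCode_le hk c dec wc wc' s
    have := mul_le_mul_of_nonneg_left hq₂ (Nat.cast_nonneg (α := ℝ) (m + k))
    linarith

theorem errorProb_stateRelayCode_le {p η : ℝ} (hp : p ∈ Set.Icc (0 : ℝ) 1) (hMc : Mc = 1)
    (hM : 0 < M)
    (hc : ∀ w, ∑ z : Fin m → ZMod 2, (∏ i, bern p (z i)) *
      (if dec (c w + z) = w then 0 else 1) ≤ η) :
    (stateRelayCode hk c dec wc).errorProb (binaryMAC p hp) ≤ η + m / (k : ℝ) ^ 2 := by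
  classical
  subst hMc
  have hbp : bern p ∈ stdSimplex ℝ (ZMod 2) := bern_mem hp
  have hQ : bern (1 / 2) ∈ stdSimplex ℝ (ZMod 2) := bern_mem (by norm_num)
  have hη : 0 ≤ η := (hc ⟨0, hM⟩).trans' <| Finset.sum_nonneg fun z _ =>
    mul_nonneg (Finset.prod_nonneg fun i _ => hbp.1 _) (by split_ifs <;> norm_num)
  have hkR : (0 : ℝ) < k := by exact_mod_cast hk
  have hatyp : ∑ s : Fin (m + k) → ZMod 2, (∏ i, bern (1 / 2) (s i)) *
      (if 2 * ∑ j : Fin m, (s (Fin.castAdd k j)).val ≤ m + k then 0 else 1) ≤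
        m / (k : ℝ) ^ 2 := by
    rw [sum_prod_castAdd m k hQ.2 (fun s => if 2 * ∑ j, (s j).val ≤ m + k then (0 : ℝ) else 1)]
    have hmean : ∑ b, bern (1 / 2) b * ((b.val : ℕ) : ℝ) = 1 / 2 := by
      rw [sum_zmod_two]
      simp [ZMod.val_one]
    have hvar : ∑ b, bern (1 / 2) b * (((b.val : ℕ) : ℝ) - 1 / 2) ^ 2 = 1 / 4 := by
      rw [sum_zmod_two]
      norm_num [ZMod.val_one]
    -- Stopping requires the weight of `m` fair bits to exceed its mean `m / 2` by more than `k /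
    -- 2`. With variance `m / 4`, Chebyshev gives `m / k ^ 2`.
    have h := sum_prod_ite_le_of_dev hQ (fun b => ((b.val : ℕ) : ℝ)) m
      (d := k / 2) (by positivity) (fun s => ¬ 2 * ∑ j, (s j).val ≤ m + k) ?_
    · rw [hmean, hvar] at h
      refine (le_of_eq_of_le (Finset.sum_congr rfl fun s _ => ?_) h).trans_eq ?_
      · congr 1
        split_ifs <;> simp_all
      · field_simp
        norm_num
    · intro s _ hs
      rw [hmean]
      refine le_trans ?_ (le_abs_self _)
      have : ((m + k : ℕ) : ℝ) < 2 * ∑ j, ((s j).val : ℝ) := by exact_mod_cast not_le.1 hs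
      push_cast at this
      linarith
  have hw : ∀ w, ∑ s : Fin (m + k) → ZMod 2, (∏ i, bern (1 / 2) (s i)) *
      ∑ z : Fin (m + k) → ZMod 2, (∏ i, bern p (z i)) *
        (if (stateRelayCode hk c dec wc).dec (fun i =>
          ((stateRelayCode hk c dec wc).enc₁ 0 w s i + s i + z i,
            (stateRelayCode hk c dec wc).word₂ 0 s i)) = (0, w) then 0 else 1) ≤
      η + m / (k : ℝ) ^ 2 := by
    intro w
    calc _ ≤ ∑ s : Fin (m + k) → ZMod 2, (∏ i, bern (1 / 2) (s i)) *
          (η + (if 2 * ∑ j : Fin m, (s (Fin.castAdd k j)).val ≤ m + k then 0 else 1)) := by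
          refine Finset.sum_le_sum fun s _ => mul_le_mul_of_nonneg_left ?_
            (Finset.prod_nonneg fun i _ => hQ.1 _)
          split_ifs with hs
          · rw [add_zero]
            refine le_trans (le_of_eq ?_) (hc w)
            rw [← sum_prod_castAdd m k hbp.2 (fun z => if dec (c w + z) = w then (0 : ℝ) else 1)]
            refine Finset.sum_congr rfl fun z _ => ?_
            congr 1
            refine if_congr ?_ rfl rfl
            rw [Prod.ext_iff]
            have hd : ((stateRelayCode hk c dec wc).dec (fun i =>
                ((stateRelayCode hk c dec wc).enc₁ 0 w s i + s i + z i,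
                  (stateRelayCode hk c dec wc).word₂ 0 s i))).2 =
                dec (c w + fun i => z (Fin.castAdd k i)) := by
              change dec _ = _
              congr 1
              funext j
              change Fin.append (c w) (fun _ => 0) (Fin.castAdd k j) + s (Fin.castAdd k j)
                + z (Fin.castAdd k j) - (stateRelayCode hk c dec wc).word₂ 0 s ⟨(j : ℕ) + 1, _⟩ = _
              rw [word₂_stateRelayCode hk c dec wc 0 s hs j, Fin.append_left]
              simp only [Pi.add_apply]
              ring
            exact ⟨fun h => hd.symm.trans h.2, fun h => ⟨Subsingleton.elim _ _, hd.trans h⟩⟩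
          -- When the relay may stop early, the conditional error is bounded by 1.
          · refine le_trans ?_ (le_add_of_nonneg_left hη)
            refine le_of_le_of_eq (Finset.sum_le_sum fun z _ => ?_)
              (sum_prod_pmf_eq_one (n := m + k) fun _ => hbp.2)
            exact mul_le_of_le_one_right (Finset.prod_nonneg fun i _ => hbp.1 _)
              (by split_ifs <;> norm_num)
      _ ≤ η + m / (k : ℝ) ^ 2 := by
          simp only [mul_add, Finset.sum_add_distrib, ← Finset.sum_mul,
            sum_prod_pmf_eq_one (n := m + k) fun _ => hQ.2, one_mul]
          linarith
  rw [errorProb_binaryMAC]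
  simp only [Fin.sum_univ_one, Nat.cast_one, one_mul]
  have hs := Finset.sum_le_sum fun w (_ : w ∈ Finset.univ) => hw w
  rw [Finset.sum_const, Finset.card_univ, Fintype.card_fin, nsmul_eq_mul] at hs
  rw [one_div, ← div_eq_inv_mul, div_le_iff₀ (by exact_mod_cast hM), mul_comm]
  exact hs

end StateRelay

/-! ### Assembly of the capacity. -/

section Capacity

variable {p q₁ q₂ : ℝ}

theorem achievable_zero (hp : p ∈ Set.Icc (0 : ℝ) 1) (hq₁ : 0 ≤ q₁) (hq₂ : 1 / 2 ≤ q₂) :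
    (binaryMAC p hp).Achievable q₁ q₂ 0 0 := by
  refine ⟨le_rfl, le_rfl, fun ε hε => ⟨1, le_rfl, ?_⟩⟩
  rw [ceil_two_rpow_mul_zero]
  refine ⟨⟨fun _ _ _ _ => 0, fun _ _ _ => 0, fun _ => (0, 0)⟩, ⟨fun _ _ _ => ?_, fun _ _ => ?_⟩, ?_⟩
  · simpa using hq₁
  · simp only [MACCode.word₂, ZMod.val_zero, Nat.cast_zero, Finset.sum_const_zero, Nat.cast_one]
    linarith
  · have h : ∀ x y : Fin 1 × Fin 1, x = y := fun x y => Subsingleton.elim x y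
    simp only [MACCode.errorProb, if_pos (h _ _), Finset.sum_const_zero, mul_zero]
    exact hε.le

/-- Achievability of all rates below the information of a strictly admissible input. -/
theorem achievable_of_mul_log_two_lt (hp : p ∈ Set.Icc (0 : ℝ) 1) (hq₂ : 1 / 2 ≤ q₂) {a R : ℝ}
    (ha0 : 0 < a) (ha1 : a < 1) (haq : a < q₁) (hR0 : 0 ≤ R)
    (hR : R * Real.log 2 < bscInfo a p) : (binaryMAC p hp).Achievable q₁ q₂ 0 R := by
  refine ⟨le_rfl, hR0, fun ε hε => ?_⟩
  obtain ⟨ρ, hρ1, hρ2⟩ := exists_between hR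
  -- Codeword length `K j` and tail length `j` give block length `(K + 1) j`. This `K` ensures `(K +
  -- 1) R log 2 < K ρ`, so the tail does not spoil the rate, while the stopping probability is at
  -- most `K / j → 0`.
  obtain ⟨K, hK⟩ := exists_nat_gt (R * Real.log 2 / (ρ - R * Real.log 2))
  rw [div_lt_iff₀ (sub_pos.2 hρ1)] at hK
  have hlog2 : 0 < Real.log 2 := Real.log_pos (by norm_num)
  have hK0 : 0 < K := by
    rcases Nat.eq_zero_or_pos K with h | h
    · rw [h] at hK
      have := mul_nonneg hR0 hlog2.le
      simp at hK
      linarith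
    · exact h
  set θ := K * ρ - (K + 1) * (R * Real.log 2) with hθ
  have hθ0 : 0 < θ := by rw [hθ]; linarith
  have hlim1 : Filter.Tendsto (fun j : ℕ => 2 * Real.exp (-(j * θ))) Filter.atTop
      (nhds (2 * 0)) := by
    refine Filter.Tendsto.const_mul 2 (Real.tendsto_exp_neg_atTop_nhds_zero.comp ?_)
    exact tendsto_natCast_atTop_atTop.atTop_mul_const hθ0
  have hlim2 : Filter.Tendsto (fun j : ℕ => (K : ℝ) / j) Filter.atTop (nhds 0) :=
    tendsto_const_div_atTop_nhds_zero_nat _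
  have hKt : Filter.Tendsto (fun j : ℕ => K * j) Filter.atTop Filter.atTop :=
    Filter.tendsto_id.const_mul_atTop' hK0
  rw [mul_zero] at hlim1
  -- The level `ε / 6` becomes error `3 (ε / 6) = ε / 2` for the symmetric channel. The relay takes
  -- the other `ε / 2`.
  obtain ⟨j, hcode, hj1, hj2, hj0⟩ := ((hKt.eventually (eventually_exists_bsc_code hp ha0 ha1 haq hρ2
    (show 0 < ε / 6 by positivity))).and
    ((hlim1.eventually_lt_const (show 0 < ε / 6 by positivity)).and
      ((hlim2.eventually_lt_const (show 0 < ε / 2 by positivity)).and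
        (Filter.eventually_gt_atTop 0)))).exists
  have hjR : (0 : ℝ) < j := by exact_mod_cast hj0
  refine ⟨K * j + j, by omega, ?_⟩
  have hM0 := ceil_two_rpow_pos (((K * j + j : ℕ) : ℝ) * R)
  obtain ⟨c, dec, hc⟩ := hcode _ hM0 (by
    refine lt_of_le_of_lt ?_ hj1
    have hexp : (2 : ℝ) ^ (((K * j + j : ℕ) : ℝ) * R) =
        Real.exp (((K * j + j : ℕ) : ℝ) * (R * Real.log 2)) := by
      rw [Real.rpow_def_of_pos (by norm_num)]
      ring_nf
    have h1 : (1 : ℝ) ≤ (2 : ℝ) ^ (((K * j + j : ℕ) : ℝ) * R) :=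
      Real.one_le_rpow (by norm_num) (by positivity)
    -- Rounding up costs at most a factor 2, since the power is at least 1.
    have h2 := (Nat.ceil_lt_add_one (zero_le_one.trans h1)).le
    calc _ ≤ (2 * (2 : ℝ) ^ (((K * j + j : ℕ) : ℝ) * R)) * Real.exp (-(((K * j : ℕ) : ℝ) * ρ)) :=
          mul_le_mul_of_nonneg_right (by linarith) (Real.exp_pos _).le
      _ = 2 * Real.exp (-(j * θ)) := by
          rw [hexp, mul_assoc, ← Real.exp_add, hθ]
          push_cast
          ring_nf)
  have hMc := ceil_two_rpow_mul_zero (K * j + j)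
  refine ⟨stateRelayCode hj0 c dec ⟨0, by rw [hMc]; exact one_pos⟩,
    weightConstrained_stateRelayCode hj0 c dec _ (ha0.trans haq).le hq₂ (fun w => (hc w).1),
    (errorProb_stateRelayCode_le hj0 c dec _ hp hMc hM0 (fun w => (hc w).2)).trans ?_⟩
  have h3 : ((K * j : ℕ) : ℝ) / (j : ℝ) ^ 2 = K / j := by
    push_cast
    field_simp
  rw [h3]
  linarith

/-- The supremum of the achievable rates. -/
theorem isLUB_achievable (hp : p ∈ Set.Icc (0 : ℝ) 1) (hq₁ : 0 ≤ q₁) (hq₂ : 1 / 2 ≤ q₂) :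
    IsLUB {R : ℝ | (binaryMAC p hp).Achievable q₁ q₂ 0 R}
      (bscInfo (min q₁ (1 / 2)) p / Real.log 2) := by
  refine ⟨fun R hR => StateMAC.Achievable.rate_le hp hq₁ hR, fun b hb => ?_⟩
  have hb0 : 0 ≤ b := hb (achievable_zero hp hq₁ hq₂)
  refine le_of_forall_lt_imp_le_of_dense fun R hR => ?_
  rcases lt_or_ge R 0 with hR0 | hR0
  · exact hR0.le.trans hb0
  refine hb ?_
  rw [lt_div_iff₀ (Real.log_pos (by norm_num))] at hR
  -- For `q₁ = 0` the claimed capacity is 0, so no rate `R ≥ 0` lies strictly below it. Otherwise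
  -- continuity leaves room for a positive `a` strictly below the constraint.
  have ha0 : 0 < min q₁ (1 / 2) := by
    refine lt_of_le_of_ne (le_min hq₁ (by norm_num)) fun h => ?_
    rw [← h] at hR
    have : bscInfo 0 p = 0 := by simp [bscInfo, binConv]
    have := mul_nonneg hR0 (Real.log_pos (show (1 : ℝ) < 2 by norm_num)).le
    linarith
  have hev := (((continuous_bscInfo p).tendsto (min q₁ (1 / 2))).mono_left
    (nhdsWithin_le_nhds (s := Set.Iio (min q₁ (1 / 2))))).eventually_const_lt hR
  obtain ⟨a, haR, ha⟩ := (hev.and (Ioo_mem_nhdsLT ha0)).exists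
  exact achievable_of_mul_log_two_lt hp hq₂ ha.1
    ((ha.2.trans_le (min_le_right _ _)).trans (by norm_num)) (ha.2.trans_le (min_le_left _ _))
    hR0 haR

end Capacity

theorem claim1 (p q₁ q₂ : ℝ) (hp : p ∈ Set.Icc (0 : ℝ) 1) (hq₁ : 0 ≤ q₁) (hq₂ : 1 / 2 ≤ q₂) :
    ∃ C : ℝ,
      IsGreatest ((fun r => condMutualInfo (singleLetterLaw p r)) '' AdmissibleInput q₁) C ∧
      IsLUB {R : ℝ | (binaryMAC p hp).Achievable q₁ q₂ 0 R} C :=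
  ⟨_, isGreatest_condMutualInfo hp hq₁, isLUB_achievable hp hq₁ hq₂⟩
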